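/- Let $1\le d<n$ be integers, let $\Gamma\subset\mathbb R^n$ be bounded, and let $\mu$ be a finite Borel measure carried by $\Gamma$ (i.e. $\mu(\mathbb R^n\setminus\Gamma)=0$); for instance, $\Gamma$ is a $d$-dimensional surface of finite $d$-dimensional measure and $\mu$ is the surface measure of $\Gamma$ or the $d$-dimensional Hausdorff measure restricted to $\Gamma$. For $x\in\mathbb R^n$ and $t>0$ put $$K_t(x)=t^{-d/2}e^{-\pi|x|^2/t},\qquad \psi_t(x)=t\,\frac{\partial}{\partial t}K_t(x),\qquad S\Gamma(x,t)=\int_\Gamma\psi_t(x-y)\,d\mu(y).$$ Fix $a>1$ and write $S\Gamma(x,\tau):=S\Gamma(x,a^\tau)$ for $\tau=\log_a t\in\mathbb R$. Assume: 1. for every integer $k\ge1$, the Littlewood–Paley function $$g_k(f)(x)=\Big[\int_0^\infty\Big|t^k\int_\Gamma\frac{\partial^kK_t}{\partial t^k}(x-y)f(y)\,d\mu(y)\Big|^2\frac{dt}{t}\Big]^{1/2}$$ is bounded on $L^2(\Gamma,\mu)$: there is a finite constant $C$, which may depend on $k$ and $\Gamma$, with $\|g_k(f)\|_{L^2(\Gamma)}\le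 C\|f\|_{L^2(\Gamma)}$ for all real-valued $f\in L^2(\Gamma,\mu)$; 2. for every integer $k\ge0$ there is a finite constant $C_k$ with $\left|\frac{\partial^k}{\partial\tau^k}S\Gamma(x,\tau)\right|\le C_k$ for all $x\in\Gamma$ and $\tau\in\mathbb R$. For $x\in\Gamma$ let $\mathcal T_\Gamma(x)$ be the set of all $\tau=\log_a t$ such that $t>0$ is a local maximum of $s\mapsto|S\Gamma(x,s)|$ on $(0,\infty)$ (the logarithmic local scales of $\Gamma$ at $x$). For $\delta>0$ and an integer $N\ge0$ let $$\mathcal T_\delta(x)=\Big\{\tau\in\mathcal T_\Gamma(x):\Big|\frac{\partial^2}{\partial\tau^2}S\Gamma(x,\tau)\Big|>\delta\Big\},\qquad \Gamma_{\delta,N}=\{x\in\Gamma:\#\mathcal T_\delta(x)>N\}.$$ Then there are constants $C_1,C_2>0$, independent of $\delta$ and $N$ (but allowed to depend on $\Gamma$, $\mu$ and $a$), such that for all $\delta>0$ and all integers $N\ge0$ $$\mu(\Gamma_{\delta,N})\le C_1e^{-C_2\delta^3N}.$$ -/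

import Mathlib

open MeasureTheory Set
open scoped ENNReal

noncomputable section

namespace LocalScales

variable {n : ℕ}

/-- The Gaussian `φ(x) = exp (-π |x|²)` on `ℝⁿ`. -/
def phi (x : EuclideanSpace ℝ (Fin n)) : ℝ := Real.exp (-Real.pi * ‖x‖ ^ 2)

/-- The `d`-dimensional heat kernel `K_t(x) = t^(-d/2) φ(x / √t)` on `ℝⁿ`, for `t > 0`. -/
def heatKernel (d : ℕ) (t : ℝ) (x : EuclideanSpace ℝ (Fin n)) : ℝ :=
  t ^ (-(d : ℝ) / 2) * phi ((Real.sqrt t)⁻¹ • x)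

/-- The wavelet `ψ_t(x) = t ∂_t K_t(x)`. -/
def psi (d : ℕ) (t : ℝ) (x : EuclideanSpace ℝ (Fin n)) : ℝ :=
  t * deriv (fun s : ℝ => heatKernel d s x) t

/-- `SΓ(x,t) = (ψ_t * μ)(x) = ∫ ψ_t(x - y) dμ(y)`, where `μ` is the measure carried by `Γ`. -/
def scaleTransform (d : ℕ) (μ : Measure (EuclideanSpace ℝ (Fin n)))
    (x : EuclideanSpace ℝ (Fin n)) (t : ℝ) : ℝ :=
  ∫ y, psi d t (x - y) ∂μ

/-- `SΓ(x,τ) := SΓ(x,t)` in the logarithmic scale `τ = log_a t`, that is, `t = a^τ`. -/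
def logScaleTransform (d : ℕ) (a : ℝ) (μ : Measure (EuclideanSpace ℝ (Fin n)))
    (x : EuclideanSpace ℝ (Fin n)) (τ : ℝ) : ℝ :=
  scaleTransform d μ x (a ^ τ)

/-- The Littlewood–Paley function
`g_k(f)(x) = (∫₀^∞ |t^k (∂_t^k K_t * f)(x)|² dt/t)^(1/2)`, with values in `[0, ∞]`; here
`(∂_t^k K_t * f)(x) = ∫ ∂_t^k K_t(x - y) f(y) dμ(y)`. -/
def littlewoodPaley (d k : ℕ) (μ : Measure (EuclideanSpace ℝ (Fin n)))
    (f : EuclideanSpace ℝ (Fin n) → ℝ) (x : EuclideanSpace ℝ (Fin n)) : ℝ≥0∞ :=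
  (∫⁻ t in Ioi (0 : ℝ), ENNReal.ofReal
    (|t ^ k * ∫ y, iteratedDeriv k (fun s : ℝ => heatKernel d s (x - y)) t * f y ∂μ| ^ 2 / t))
      ^ (1 / 2 : ℝ)

/-- For every `k ≥ 1`, the Littlewood–Paley function `g_k` is bounded on `L²(μ)`. -/
def LittlewoodPaleyBounded (d : ℕ) (μ : Measure (EuclideanSpace ℝ (Fin n))) : Prop :=
  ∀ k : ℕ, 1 ≤ k → ∃ C : NNReal, ∀ f : EuclideanSpace ℝ (Fin n) → ℝ, MemLp f 2 μ →
    eLpNorm (littlewoodPaley d k μ f) 2 μ ≤ C * eLpNorm f 2 μ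

/-- For every `k ≥ 0`, `∂_τ^k SΓ(x,τ)` is bounded uniformly in `x ∈ Γ` and `τ ∈ ℝ`. -/
def LogDerivBounded (d : ℕ) (a : ℝ) (Γ : Set (EuclideanSpace ℝ (Fin n)))
    (μ : Measure (EuclideanSpace ℝ (Fin n))) : Prop :=
  ∀ k : ℕ, ∃ C : ℝ, ∀ x ∈ Γ, ∀ τ : ℝ,
    |iteratedDeriv k (logScaleTransform d a μ x) τ| ≤ C

/-- The set `T_Γ(x)` of local scales of `Γ` at `x`: the `t > 0` at which `|SΓ(x,·)|` has a
local maximum. -/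
def localScales (d : ℕ) (μ : Measure (EuclideanSpace ℝ (Fin n)))
    (x : EuclideanSpace ℝ (Fin n)) : Set ℝ :=
  {t | 0 < t ∧ IsLocalMax (fun s : ℝ => |scaleTransform d μ x s|) t}

/-- The set `{log_a t : t ∈ T_Γ(x)}` of logarithmic local scales. -/
def logLocalScales (d : ℕ) (a : ℝ) (μ : Measure (EuclideanSpace ℝ (Fin n)))
    (x : EuclideanSpace ℝ (Fin n)) : Set ℝ :=
  Real.logb a '' localScales d μ x

/-- The set of `δ`-separated logarithmic local scales at `x`. -/
def separatedScales (d : ℕ) (a : ℝ) (μ : Measure (EuclideanSpace ℝ (Fin n))) (δ : ℝ)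
    (x : EuclideanSpace ℝ (Fin n)) : Set ℝ :=
  {τ ∈ logLocalScales d a μ x | δ < |iteratedDeriv 2 (logScaleTransform d a μ x) τ|}

/-- `Γ_{δ,N}`: the points of `Γ` having more than `N` (possibly infinitely many)
`δ`-separated local scales. -/
def manyScales (d : ℕ) (a : ℝ) (Γ : Set (EuclideanSpace ℝ (Fin n)))
    (μ : Measure (EuclideanSpace ℝ (Fin n))) (δ : ℝ) (N : ℕ) :
    Set (EuclideanSpace ℝ (Fin n)) :=
  {x ∈ Γ | (N : ℕ∞) < (separatedScales d a μ δ x).encard}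

end LocalScales

end

/-! In the variable `σ = log t`, the second derivative of `SΓ` is the convolution of `μ` with `(t
∂_t)^3 K_t`, a kernel of the form treated by `polyKernel`. Let `G(x)` be the integral over `σ` of
its square. The claim reduces to two facts: a point of `Γ_{δ,N}` has `G` at least of order `δ^3 N`,
and `G` has exponentially decaying distribution.

The first is elementary calculus (`card_mul_le_lintegral_sq`). Separated scales are zeros of the
first derivative with large slope; a bound on the third derivative keeps them apart and keeps the
slope large nearby, so each one contributes order `δ^3`.

The second is a good-λ argument (`exists_measureReal_squareFunction_le_half`). Testing the
Littlewood–Paley bounds on balls gives `μ(B(x,r)) ≲ r^d` (`exists_measure_ball_le`), hence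
scale-invariant size, Lipschitz and tail bounds for the convolutions. Thus the large-scale part of
`G` is almost constant on balls of the matching radius. Where `G` far exceeds `l`, the excess comes
from scales smaller than the distance to the complement of `Ω = {G > l}`, up to a bounded factor.
Those scales mainly see `μ` restricted to `Ω`, so Chebyshev and the L² bound for the indicator of
`Ω` give `μ{G > l + K} ≤ μ{G > l} / 2`. -/

noncomputable section

namespace LocalScales

variable {n : ℕ}

/-! ### Heat kernel derivatives in logarithmic scale -/

open Polynomial in
/-- The operator on polynomials that represents `t ∂_t` on functions
`t^(-d/2) p(|z|²/t) exp (-π|z|²/t)`. -/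
def eulerOp (d : ℕ) (p : ℝ[X]) : ℝ[X] :=
  C (-(d : ℝ) / 2) * p - X * derivative p + C Real.pi * X * p

/-- The polynomials `p` for which `t^k ∂_t^k K_t(z) = t^(-d/2) p(|z|²/t) exp (-π|z|²/t)`. -/
def derivPoly (d : ℕ) : ℕ → Polynomial ℝ
  | 0 => 1
  -- This is `t^(k+1) ∂_t^(k+1) = (t ∂_t - k) (t^k ∂_t^k)`.
  | k + 1 => eulerOp d (derivPoly d k) - Polynomial.C (k : ℝ) * derivPoly d k

/-- The profile `u ↦ p(u) exp (-π u)`. -/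
def profile (p : Polynomial ℝ) (u : ℝ) : ℝ := p.eval u * Real.exp (-Real.pi * u)

/-- The kernel `t^(-d/2) p(|z|²/t) exp (-π|z|²/t)` at `t = exp σ`. -/
def polyKernel (d : ℕ) (p : Polynomial ℝ) (σ : ℝ) (z : EuclideanSpace ℝ (Fin n)) : ℝ :=
  Real.exp (-(d : ℝ) / 2 * σ) * profile p (‖z‖ ^ 2 * Real.exp (-σ))

/-- Convolution of a measure with `polyKernel`. -/
def polyTransform (d : ℕ) (p : Polynomial ℝ) (ν : Measure (EuclideanSpace ℝ (Fin n)))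
    (σ : ℝ) (x : EuclideanSpace ℝ (Fin n)) : ℝ :=
  ∫ y, polyKernel d p σ (x - y) ∂ν

theorem hasDerivAt_profile (p : Polynomial ℝ) (u : ℝ) :
    HasDerivAt (profile p)
      (profile (Polynomial.derivative p - Polynomial.C Real.pi * p) u) u := by
  have h1 := p.hasDerivAt u
  have h2 : HasDerivAt (fun u : ℝ => Real.exp (-Real.pi * u))
      (Real.exp (-Real.pi * u) * (-Real.pi * 1)) u :=
    ((hasDerivAt_id u).const_mul (-Real.pi)).exp
  refine (h1.mul h2).congr_deriv ?_
  simp only [profile, Polynomial.eval_sub, Polynomial.eval_mul, Polynomial.eval_C]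
  ring

theorem continuous_profile (p : Polynomial ℝ) : Continuous (profile p) :=
  continuous_iff_continuousAt.2 fun u => (hasDerivAt_profile p u).continuousAt

theorem continuous_polyKernel (d : ℕ) (p : Polynomial ℝ) :
    Continuous fun q : ℝ × EuclideanSpace ℝ (Fin n) => polyKernel d p q.1 q.2 := by
  unfold polyKernel
  have := continuous_profile p
  fun_prop

theorem hasDerivAt_polyKernel (d : ℕ) (p : Polynomial ℝ) (σ : ℝ)
    (z : EuclideanSpace ℝ (Fin n)) :
    HasDerivAt (fun σ => polyKernel d p σ z) (polyKernel d (eulerOp d p) σ z) σ := by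
  have h1 : HasDerivAt (fun σ : ℝ => Real.exp (-(d : ℝ) / 2 * σ))
      (Real.exp (-(d : ℝ) / 2 * σ) * (-(d : ℝ) / 2 * 1)) σ :=
    ((hasDerivAt_id σ).const_mul _).exp
  have h2 : HasDerivAt (fun σ : ℝ => ‖z‖ ^ 2 * Real.exp (-σ))
      (‖z‖ ^ 2 * (Real.exp (-σ) * -1)) σ :=
    ((hasDerivAt_neg σ).exp).const_mul _
  have h3 := (hasDerivAt_profile p _).comp σ h2
  refine (h1.mul h3).congr_deriv ?_
  simp only [polyKernel, profile, eulerOp, Polynomial.eval_sub, Polynomial.eval_mul,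
    Polynomial.eval_C, Polynomial.eval_add, Polynomial.eval_X, Function.comp]
  ring

theorem heatKernel_eq_polyKernel (d : ℕ) {t : ℝ} (ht : 0 < t) (z : EuclideanSpace ℝ (Fin n)) :
    heatKernel d t z = polyKernel d 1 (Real.log t) z := by
  simp only [heatKernel, phi, polyKernel, profile, Polynomial.eval_one, one_mul]
  rw [Real.rpow_def_of_pos ht, Real.exp_neg, Real.exp_log ht, norm_smul, mul_pow,
    Real.norm_eq_abs, sq_abs, inv_pow, Real.sq_sqrt ht.le]
  congr 2 <;> ring

theorem iteratedDeriv_heatKernel (d k : ℕ) (z : EuclideanSpace ℝ (Fin n)) :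
    ∀ t : ℝ, 0 < t → iteratedDeriv k (fun s : ℝ => heatKernel d s z) t =
      Real.exp (-k * Real.log t) * polyKernel d (derivPoly d k) (Real.log t) z := by
  induction k with
  | zero => intro t ht; simp [derivPoly, heatKernel_eq_polyKernel d ht]
  | succ k ih =>
    intro t ht
    rw [iteratedDeriv_succ]
    have h1 : HasDerivAt (fun σ : ℝ => Real.exp (-(k : ℝ) * σ) * polyKernel d (derivPoly d k) σ z)
        (Real.exp (-(k : ℝ) * Real.log t) * (-(k : ℝ) * 1) *
          polyKernel d (derivPoly d k) (Real.log t) z +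
          Real.exp (-(k : ℝ) * Real.log t) *
            polyKernel d (eulerOp d (derivPoly d k)) (Real.log t) z) (Real.log t) :=
      ((hasDerivAt_id (Real.log t)).const_mul (-(k : ℝ))).exp.mul (hasDerivAt_polyKernel d _ _ z)
    have h2 := h1.comp t (Real.hasDerivAt_log ht.ne')
    have h3 : iteratedDeriv k (fun s : ℝ => heatKernel d s z) =ᶠ[nhds t]
        (fun σ : ℝ => Real.exp (-(k : ℝ) * σ) * polyKernel d (derivPoly d k) σ z) ∘ Real.log := by
      filter_upwards [lt_mem_nhds ht] with s hs using ih s hs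
    rw [h3.deriv_eq, h2.deriv]
    have h4 : t⁻¹ = Real.exp (-Real.log t) := by rw [Real.exp_neg, Real.exp_log ht]
    have h5 : Real.exp (-((k + 1 : ℕ) : ℝ) * Real.log t) =
        Real.exp (-(k : ℝ) * Real.log t) * Real.exp (-Real.log t) := by
      rw [← Real.exp_add]; push_cast; ring_nf
    rw [h4, h5]
    simp only [derivPoly, polyKernel, profile, Polynomial.eval_sub, Polynomial.eval_mul,
      Polynomial.eval_C]
    ring

theorem pow_mul_iteratedDeriv_heatKernel (d k : ℕ) (z : EuclideanSpace ℝ (Fin n)) {t : ℝ}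
    (ht : 0 < t) : t ^ k * iteratedDeriv k (fun s : ℝ => heatKernel d s z) t =
      polyKernel d (derivPoly d k) (Real.log t) z := by
  rw [iteratedDeriv_heatKernel d k z t ht, ← mul_assoc, neg_mul, Real.exp_neg,
    ← Real.log_pow, Real.exp_log (by positivity), mul_inv_cancel₀ (by positivity), one_mul]

theorem logScaleTransform_eq (d : ℕ) {a : ℝ} (ha : 1 < a)
    (μ : Measure (EuclideanSpace ℝ (Fin n))) (x : EuclideanSpace ℝ (Fin n)) (τ : ℝ) :
    logScaleTransform d a μ x τ = polyTransform d (derivPoly d 1) μ (τ * Real.log a) x := by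
  have ha0 : 0 < a := by linarith
  have ht : 0 < a ^ τ := Real.rpow_pos_of_pos ha0 τ
  simp only [logScaleTransform, scaleTransform, polyTransform, psi]
  congr 1
  ext y
  have := pow_mul_iteratedDeriv_heatKernel d 1 (x - y) ht
  rw [pow_one, iteratedDeriv_one, Real.log_rpow ha0] at this
  exact this

/-! ### Decay and Lipschitz bounds for the kernels -/

theorem exists_abs_eval_le (p : Polynomial ℝ) :
    ∃ C : ℝ, 0 ≤ C ∧ ∀ u : ℝ, 0 ≤ u → |p.eval u| ≤ C * Real.exp u := by
  induction p using Polynomial.induction_on' with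
  | add p q hp hq =>
    obtain ⟨A, hA, hp⟩ := hp
    obtain ⟨B, hB, hq⟩ := hq
    refine ⟨A + B, by positivity, fun u hu => ?_⟩
    rw [Polynomial.eval_add, add_mul]
    exact (abs_add_le _ _).trans (add_le_add (hp u hu) (hq u hu))
  | monomial k c =>
    refine ⟨|c| * k.factorial, by positivity, fun u hu => ?_⟩
    have h := Real.pow_div_factorial_le_exp u hu k
    rw [div_le_iff₀ (by positivity)] at h
    rw [Polynomial.eval_monomial, abs_mul, abs_of_nonneg (pow_nonneg hu k), mul_assoc]
    gcongr
    linarith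

/-- Here `v` stands for `|z|/√t`. Of the two factors `exp (-v)`, one is integrated against `μ` and
the other is kept for the gain away from `Ω`. -/
theorem exists_abs_profile_sq_le (p : Polynomial ℝ) :
    ∃ C : ℝ, 0 ≤ C ∧ ∀ v : ℝ, |profile p (v ^ 2)| ≤ C * Real.exp (-2 * v) := by
  obtain ⟨C, hC, h⟩ := exists_abs_eval_le p
  refine ⟨C * Real.exp 1, by positivity, fun v => ?_⟩
  rw [profile, abs_mul, Real.abs_exp]
  calc |p.eval (v ^ 2)| * Real.exp (-Real.pi * v ^ 2)
      ≤ C * Real.exp (v ^ 2) * Real.exp (-Real.pi * v ^ 2) := by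
        gcongr; exact h _ (sq_nonneg v)
    _ = C * Real.exp (v ^ 2 + -Real.pi * v ^ 2) := by rw [mul_assoc, ← Real.exp_add]
    _ ≤ C * Real.exp (1 + -2 * v) := by
        refine mul_le_mul_of_nonneg_left (Real.exp_le_exp.2 ?_) hC
        nlinarith [Real.pi_gt_three, sq_nonneg (v - 1), sq_nonneg v]
    _ = C * Real.exp 1 * Real.exp (-2 * v) := by rw [mul_assoc, ← Real.exp_add]

theorem exists_abs_profile_sq_sub_le (p : Polynomial ℝ) :
    ∃ C : ℝ, 0 ≤ C ∧ ∀ v w : ℝ, 0 ≤ v → 0 ≤ w → |v - w| ≤ 1 →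
      |profile p (v ^ 2) - profile p (w ^ 2)| ≤ C * |v - w| * Real.exp (-2 * v) := by
  set p' := Polynomial.derivative p - Polynomial.C Real.pi * p with hp'
  -- The factor `1 + X` absorbs the `2x` from differentiating `x ^ 2`, because `2x ≤ 1 + x ^ 2`.
  obtain ⟨C, hC, h⟩ := exists_abs_profile_sq_le ((1 + Polynomial.X) * p')
  refine ⟨C * Real.exp 2, by positivity, fun v w hv hw hvw => ?_⟩
  have hd : ∀ x ∈ Ici (v - 1) ∩ Ici 0, HasDerivWithinAt (fun x => profile p (x ^ 2))
      (profile p' (x ^ 2) * (2 * x)) (Ici (v - 1) ∩ Ici 0) x := by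
    intro x _
    have h2 : HasDerivAt (fun x : ℝ => x ^ 2) (2 * x) x := by
      simpa using hasDerivAt_pow 2 x
    exact ((hasDerivAt_profile p (x ^ 2)).comp x h2).hasDerivWithinAt
  have hb : ∀ x ∈ Ici (v - 1) ∩ Ici 0,
      ‖profile p' (x ^ 2) * (2 * x)‖ ≤ C * (Real.exp 2 * Real.exp (-2 * v)) := by
    rintro x ⟨hx1, hx0⟩
    rw [mem_Ici] at hx1 hx0
    have e : profile ((1 + Polynomial.X) * p') (x ^ 2) = (1 + x ^ 2) * profile p' (x ^ 2) := by
      simp [profile]; ring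
    have h1 := h x
    rw [e, abs_mul, abs_of_nonneg (by positivity : 0 ≤ 1 + x ^ 2)] at h1
    rw [norm_mul, Real.norm_eq_abs, Real.norm_eq_abs, abs_of_nonneg (by positivity : 0 ≤ 2 * x)]
    calc |profile p' (x ^ 2)| * (2 * x) ≤ |profile p' (x ^ 2)| * (1 + x ^ 2) := by
          gcongr; nlinarith [sq_nonneg (x - 1)]
      _ ≤ C * Real.exp (-2 * x) := by linarith
      _ ≤ C * (Real.exp 2 * Real.exp (-2 * v)) := by
          rw [← Real.exp_add]; gcongr; linarith
  have hconv : Convex ℝ (Ici (v - 1) ∩ Ici (0 : ℝ)) := (convex_Ici _).inter (convex_Ici _)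
  have := hconv.norm_image_sub_le_of_norm_hasDerivWithin_le hd hb
    (x := w) (y := v) ⟨by have := abs_le.1 hvw; rw [mem_Ici]; linarith, hw⟩
      ⟨by rw [mem_Ici]; linarith, hv⟩
  rw [Real.norm_eq_abs, Real.norm_eq_abs] at this
  linarith

theorem norm_sq_mul_exp_neg (z : EuclideanSpace ℝ (Fin n)) (σ : ℝ) :
    ‖z‖ ^ 2 * Real.exp (-σ) = (‖z‖ * Real.exp (-σ / 2)) ^ 2 := by
  rw [mul_pow, ← Real.exp_nat_mul]
  congr 2
  push_cast; ring

theorem exists_abs_polyKernel_le (d : ℕ) (p : Polynomial ℝ) :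
    ∃ C : ℝ, 0 ≤ C ∧ ∀ σ (z : EuclideanSpace ℝ (Fin n)), |polyKernel d p σ z| ≤
      C * Real.exp (-(d : ℝ) / 2 * σ) * Real.exp (-2 * (‖z‖ * Real.exp (-σ / 2))) := by
  obtain ⟨C, hC, h⟩ := exists_abs_profile_sq_le p
  refine ⟨C, hC, fun σ z => ?_⟩
  rw [polyKernel, norm_sq_mul_exp_neg, abs_mul, Real.abs_exp]
  have := mul_le_mul_of_nonneg_left (h (‖z‖ * Real.exp (-σ / 2)))
    (Real.exp_pos (-(d : ℝ) / 2 * σ)).le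
  linarith

theorem exists_abs_polyKernel_le_exp (n d : ℕ) (p : Polynomial ℝ) :
    ∃ C : ℝ, 0 ≤ C ∧ ∀ σ (z : EuclideanSpace ℝ (Fin n)), |polyKernel d p σ z| ≤
      C * Real.exp (-(d : ℝ) / 2 * σ) := by
  obtain ⟨C, hC, h⟩ := exists_abs_polyKernel_le (n := n) d p
  refine ⟨C, hC, fun σ z => (h σ z).trans ?_⟩
  refine mul_le_of_le_one_right (by positivity) (Real.exp_le_one_iff.2 ?_)
  have : 0 ≤ ‖z‖ * Real.exp (-σ / 2) := by positivity
  linarith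

theorem integrable_polyKernel (d : ℕ) (p : Polynomial ℝ)
    (ν : Measure (EuclideanSpace ℝ (Fin n))) [IsFiniteMeasure ν] (σ : ℝ)
    (x : EuclideanSpace ℝ (Fin n)) : Integrable (fun y => polyKernel d p σ (x - y)) ν := by
  obtain ⟨C, hC, h⟩ := exists_abs_polyKernel_le_exp n d p
  refine Integrable.of_bound (C := C * Real.exp (-(d : ℝ) / 2 * σ)) ?_
    (Filter.Eventually.of_forall fun y => h σ (x - y))
  have := (continuous_polyKernel (n := n) d p).comp
    (by fun_prop : Continuous fun y : EuclideanSpace ℝ (Fin n) => (σ, x - y))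
  exact this.aestronglyMeasurable

/-! ### Convolutions: differentiation in scale and measurability -/

theorem hasDerivAt_polyTransform (d : ℕ) (p : Polynomial ℝ)
    (ν : Measure (EuclideanSpace ℝ (Fin n))) [IsFiniteMeasure ν] (σ : ℝ)
    (x : EuclideanSpace ℝ (Fin n)) :
    HasDerivAt (fun σ => polyTransform d p ν σ x) (polyTransform d (eulerOp d p) ν σ x) σ := by
  obtain ⟨C, hC, h⟩ := exists_abs_polyKernel_le_exp n d (eulerOp d p)
  refine (hasDerivAt_integral_of_dominated_loc_of_deriv_le
    (bound := fun _ => C * Real.exp ((d : ℝ) / 2 * (|σ| + 1)))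
    (F' := fun σ y => polyKernel d (eulerOp d p) σ (x - y))
    (Metric.ball_mem_nhds σ one_pos) (Filter.Eventually.of_forall fun s =>
      (integrable_polyKernel d p ν s x).aestronglyMeasurable) (integrable_polyKernel d p ν σ x)
    (integrable_polyKernel d _ ν σ x).aestronglyMeasurable
    (Filter.Eventually.of_forall fun y s hs => ?_) (integrable_const _)
    (Filter.Eventually.of_forall fun y s _ => hasDerivAt_polyKernel d p s (x - y))).2
  refine (h s (x - y)).trans ?_
  rw [Metric.mem_ball, Real.dist_eq, abs_lt] at hs
  refine mul_le_mul_of_nonneg_left (Real.exp_le_exp.2 ?_) hC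
  have : -s ≤ |σ| + 1 := by linarith [neg_abs_le σ]
  have := mul_le_mul_of_nonneg_left this (by positivity : 0 ≤ (d : ℝ) / 2)
  linarith

theorem stronglyMeasurable_polyTransform (d : ℕ) (p : Polynomial ℝ)
    (ν : Measure (EuclideanSpace ℝ (Fin n))) [IsFiniteMeasure ν] :
    StronglyMeasurable fun q : EuclideanSpace ℝ (Fin n) × ℝ =>
      polyTransform d p ν q.2 q.1 := by
  have hc : Continuous fun r : (EuclideanSpace ℝ (Fin n) × ℝ) × EuclideanSpace ℝ (Fin n) =>
      polyKernel d p r.1.2 (r.1.1 - r.2) :=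
    (continuous_polyKernel (n := n) d p).comp
      (by fun_prop : Continuous fun r : (EuclideanSpace ℝ (Fin n) × ℝ) ×
        EuclideanSpace ℝ (Fin n) => (r.1.2, r.1.1 - r.2))
  exact hc.stronglyMeasurable.integral_prod_right

/-! ### Square functions and their L² bounds on indicators -/

/-- The square function `∫ |polyTransform|² dσ`. -/
def squareFunction (d : ℕ) (p : Polynomial ℝ) (ν : Measure (EuclideanSpace ℝ (Fin n)))
    (x : EuclideanSpace ℝ (Fin n)) : ℝ≥0∞ :=
  ∫⁻ σ, ENNReal.ofReal (polyTransform d p ν σ x ^ 2)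

theorem measurable_ofReal_polyTransform_sq (d : ℕ) (p : Polynomial ℝ)
    (ν : Measure (EuclideanSpace ℝ (Fin n))) [IsFiniteMeasure ν] :
    Measurable fun q : EuclideanSpace ℝ (Fin n) × ℝ =>
      ENNReal.ofReal (polyTransform d p ν q.2 q.1 ^ 2) :=
  ((stronglyMeasurable_polyTransform d p ν).measurable.pow_const 2).ennreal_ofReal

theorem measurable_ofReal_polyTransform_sq_right (d : ℕ) (p : Polynomial ℝ)
    (ν : Measure (EuclideanSpace ℝ (Fin n))) [IsFiniteMeasure ν]
    (x : EuclideanSpace ℝ (Fin n)) :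
    Measurable fun σ => ENNReal.ofReal (polyTransform d p ν σ x ^ 2) :=
  (measurable_ofReal_polyTransform_sq d p ν).comp measurable_prodMk_left

theorem measurable_squareFunction (d : ℕ) (p : Polynomial ℝ)
    (ν : Measure (EuclideanSpace ℝ (Fin n))) [IsFiniteMeasure ν] :
    Measurable (squareFunction d p ν) :=
  (measurable_ofReal_polyTransform_sq d p ν).lintegral_prod_right

theorem lintegral_Ioi_comp_log_div (f : ℝ → ℝ) :
    ∫⁻ t in Ioi (0 : ℝ), ENNReal.ofReal (f (Real.log t) / t) = ∫⁻ σ, ENNReal.ofReal (f σ) := by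
  have h := lintegral_image_eq_lintegral_abs_deriv_mul MeasurableSet.univ
    (fun x _ => (Real.hasDerivAt_exp x).hasDerivWithinAt) Real.exp_injective.injOn
    (fun t => ENNReal.ofReal (f (Real.log t) / t))
  rw [image_univ, Real.range_exp, setLIntegral_univ] at h
  rw [h]
  refine lintegral_congr fun σ => ?_
  rw [← ENNReal.ofReal_mul (abs_nonneg _), Real.abs_exp, Real.log_exp,
    mul_div_cancel₀ _ (Real.exp_pos σ).ne']

theorem littlewoodPaley_indicator_sq (d k : ℕ) (μ : Measure (EuclideanSpace ℝ (Fin n)))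
    {Ω : Set (EuclideanSpace ℝ (Fin n))} (hΩ : MeasurableSet Ω)
    (x : EuclideanSpace ℝ (Fin n)) :
    littlewoodPaley d k μ (Ω.indicator fun _ => 1) x ^ (2 : ℝ) =
      squareFunction d (derivPoly d k) (μ.restrict Ω) x := by
  rw [littlewoodPaley, ← ENNReal.rpow_mul, squareFunction,
    ← lintegral_Ioi_comp_log_div fun σ => polyTransform d (derivPoly d k) (μ.restrict Ω) σ x ^ 2]
  norm_num only [ENNReal.rpow_one]
  refine setLIntegral_congr_fun measurableSet_Ioi fun t ht => ?_
  rw [mem_Ioi] at ht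
  rw [sq_abs, polyTransform, ← integral_indicator hΩ, ← integral_const_mul]
  congr 4
  ext y
  have h := pow_mul_iteratedDeriv_heatKernel d k (x - y) ht
  by_cases hy : y ∈ Ω <;> simp [hy, h]

theorem lintegral_squareFunction_derivPoly_le {d : ℕ} {μ : Measure (EuclideanSpace ℝ (Fin n))}
    [IsFiniteMeasure μ] (hg : LittlewoodPaleyBounded d μ) {k : ℕ} (hk : 1 ≤ k) :
    ∃ C : NNReal, ∀ Ω : Set (EuclideanSpace ℝ (Fin n)), MeasurableSet Ω →
      ∫⁻ x, squareFunction d (derivPoly d k) (μ.restrict Ω) x ∂μ ≤ C * μ Ω := by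
  obtain ⟨C, hC⟩ := hg k hk
  refine ⟨C ^ 2, fun Ω hΩ => ?_⟩
  have h := hC (Ω.indicator fun _ => 1) (memLp_indicator_const 2 hΩ 1 (Or.inr (measure_ne_top μ Ω)))
  rw [eLpNorm_indicator_const hΩ (by norm_num) (by norm_num),
    eLpNorm_eq_lintegral_rpow_enorm_toReal (by norm_num) (by norm_num)] at h
  have h2 := ENNReal.rpow_le_rpow h (by norm_num : (0 : ℝ) ≤ 2)
  rw [← ENNReal.rpow_mul, ENNReal.mul_rpow_of_nonneg _ _ (by norm_num),
    ENNReal.mul_rpow_of_nonneg _ _ (by norm_num), ← ENNReal.rpow_mul] at h2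
  norm_num at h2
  have : ∀ x, littlewoodPaley d k μ (Ω.indicator fun _ => 1) x ^ 2 =
      squareFunction d (derivPoly d k) (μ.restrict Ω) x := fun x => by
    rw [← littlewoodPaley_indicator_sq d k μ hΩ]; norm_num
  simp only [this] at h2
  exact_mod_cast h2

/-- The polynomial that represents `(t ∂_t)^3 K_t`. -/
def scalePoly (d : ℕ) : Polynomial ℝ := eulerOp d (eulerOp d (derivPoly d 1))

/-- This is `(t ∂_t)^3 = t^3 ∂_t^3 + 3 t^2 ∂_t^2 + t ∂_t`; it reduces the square function needed
here to `g_1`, `g_2`, `g_3`. -/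
theorem scalePoly_eq (d : ℕ) :
    scalePoly d = derivPoly d 3 + Polynomial.C 3 * derivPoly d 2 + derivPoly d 1 := by
  have h2 : derivPoly d 2 = eulerOp d (derivPoly d 1) - Polynomial.C ((1 : ℕ) : ℝ) * derivPoly d 1 :=
    rfl
  have h3 : derivPoly d 3 = eulerOp d (derivPoly d 2) - Polynomial.C ((2 : ℕ) : ℝ) * derivPoly d 2 :=
    rfl
  rw [h3, h2, scalePoly]
  generalize derivPoly d 1 = p
  have e1 : (Polynomial.C (3 : ℝ)) = 3 := rfl
  have e2 : (Polynomial.C (2 : ℝ)) = 2 := rfl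
  simp only [eulerOp, Polynomial.derivative_sub, Polynomial.derivative_mul, Nat.cast_one,
    Polynomial.C_1, Polynomial.derivative_one, Nat.cast_ofNat, e1, e2]
  ring

theorem eval_zero_scalePoly_ne_zero {d : ℕ} (hd : 1 ≤ d) : (scalePoly d).eval 0 ≠ 0 := by
  have hd' : (d : ℝ) ≠ 0 := by positivity
  have : (scalePoly d).eval 0 = (-(d : ℝ) / 2) ^ 3 := by
    simp [scalePoly, eulerOp, derivPoly]
    ring
  rw [this]
  exact pow_ne_zero _ (div_ne_zero (neg_ne_zero.2 hd') two_ne_zero)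

theorem polyTransform_scalePoly (d : ℕ) (ν : Measure (EuclideanSpace ℝ (Fin n)))
    [IsFiniteMeasure ν] (σ : ℝ) (x : EuclideanSpace ℝ (Fin n)) :
    polyTransform d (scalePoly d) ν σ x = polyTransform d (derivPoly d 3) ν σ x +
      3 * polyTransform d (derivPoly d 2) ν σ x + polyTransform d (derivPoly d 1) ν σ x := by
  have h := fun k => integrable_polyKernel d (derivPoly d k) ν σ x
  have h32 : Integrable (fun y => polyKernel d (derivPoly d 3) σ (x - y) +
      3 * polyKernel d (derivPoly d 2) σ (x - y)) ν := (h 3).add ((h 2).const_mul 3)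
  simp only [polyTransform]
  rw [← integral_const_mul, ← integral_add (h 3) ((h 2).const_mul 3), ← integral_add h32 (h 1)]
  congr 1
  ext y
  simp only [scalePoly_eq, polyKernel, profile, Polynomial.eval_add, Polynomial.eval_mul,
    Polynomial.eval_C]
  ring

theorem squareFunction_scalePoly_le (d : ℕ) (ν : Measure (EuclideanSpace ℝ (Fin n)))
    [IsFiniteMeasure ν] (x : EuclideanSpace ℝ (Fin n)) :
    squareFunction d (scalePoly d) ν x ≤ 27 * (squareFunction d (derivPoly d 3) ν x +
      squareFunction d (derivPoly d 2) ν x + squareFunction d (derivPoly d 1) ν x) := by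
  have hm := fun k => measurable_ofReal_polyTransform_sq_right d (derivPoly d k) ν x
  simp only [squareFunction]
  rw [← lintegral_add_right _ (hm 2), ← lintegral_add_right _ (hm 1),
    ← lintegral_const_mul' _ _ (by norm_num)]
  refine lintegral_mono fun σ => ?_
  simp only
  rw [← ENNReal.ofReal_add (sq_nonneg _) (sq_nonneg _),
    ← ENNReal.ofReal_add (by positivity) (sq_nonneg _),
    show (27 : ℝ≥0∞) = ENNReal.ofReal 27 by norm_num, ← ENNReal.ofReal_mul (by norm_num),
    polyTransform_scalePoly]
  refine ENNReal.ofReal_le_ofReal ?_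
  set u := polyTransform d (derivPoly d 3) ν σ x
  set v := polyTransform d (derivPoly d 2) ν σ x
  set w := polyTransform d (derivPoly d 1) ν σ x
  -- The first three squares give `(u + 3v + w)^2 ≤ 3 (u^2 + 9 v^2 + w^2)`.
  nlinarith [sq_nonneg (u - 3 * v), sq_nonneg (u - w), sq_nonneg (3 * v - w), sq_nonneg u,
    sq_nonneg w]

theorem exists_lintegral_squareFunction_le {d : ℕ} {μ : Measure (EuclideanSpace ℝ (Fin n))}
    [IsFiniteMeasure μ] (hg : LittlewoodPaleyBounded d μ) :
    ∃ C : NNReal, ∀ Ω : Set (EuclideanSpace ℝ (Fin n)), MeasurableSet Ω →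
      ∫⁻ x, squareFunction d (scalePoly d) (μ.restrict Ω) x ∂μ ≤ C * μ Ω := by
  obtain ⟨C₁, h₁⟩ := lintegral_squareFunction_derivPoly_le hg (k := 1) le_rfl
  obtain ⟨C₂, h₂⟩ := lintegral_squareFunction_derivPoly_le hg (k := 2) (by norm_num)
  obtain ⟨C₃, h₃⟩ := lintegral_squareFunction_derivPoly_le hg (k := 3) (by norm_num)
  refine ⟨27 * (C₃ + C₂ + C₁), fun Ω hΩ => ?_⟩
  have hm := fun k => measurable_squareFunction d (derivPoly d k) (μ.restrict Ω)
  calc ∫⁻ x, squareFunction d (scalePoly d) (μ.restrict Ω) x ∂μ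
      ≤ ∫⁻ x, 27 * (squareFunction d (derivPoly d 3) (μ.restrict Ω) x +
          squareFunction d (derivPoly d 2) (μ.restrict Ω) x +
          squareFunction d (derivPoly d 1) (μ.restrict Ω) x) ∂μ :=
        lintegral_mono fun x => squareFunction_scalePoly_le d _ x
    _ ≤ 27 * (C₃ * μ Ω + C₂ * μ Ω + C₁ * μ Ω) := by
        rw [lintegral_const_mul' _ _ (by norm_num), lintegral_add_right _ (hm 1),
          lintegral_add_right _ (hm 2)]
        gcongr
        exacts [h₃ Ω hΩ, h₂ Ω hΩ, h₁ Ω hΩ]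
    _ = _ := by push_cast; ring

/-! ### Upper regularity of the measure -/

/-- At scales `√t` comparable to `r` with a suitable constant, the kernel between points of a ball
`B` of radius `r` has the sign of `p(0)` and size about `r^(-d)`. So the square function of `μ`
restricted to `B` is at least a constant times `(μ(B)/r^d)^2` on `B`; integrating over `B` and
cancelling `μ(B)` bounds this ratio. -/
theorem exists_measure_ball_le {d : ℕ} {p : Polynomial ℝ} (hp : p.eval 0 ≠ 0)
    {μ : Measure (EuclideanSpace ℝ (Fin n))} [IsFiniteMeasure μ] {C : NNReal}
    (hC : ∀ Ω : Set (EuclideanSpace ℝ (Fin n)), MeasurableSet Ω →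
      ∫⁻ x, squareFunction d p (μ.restrict Ω) x ∂μ ≤ C * μ Ω) :
    ∃ A : ℝ, 0 ≤ A ∧ ∀ (x : EuclideanSpace ℝ (Fin n)) (r : ℝ), 0 < r →
      μ.real (Metric.ball x r) ≤ A * r ^ d := by
  set c := p.eval 0 with hc
  have hc2 : 0 < c ^ 2 := by positivity
  -- Multiplying by `c` makes the lower bound independent of the sign of `p(0)`.
  have hcont : ContinuousAt (fun u => profile p u * c) 0 :=
    ((continuous_profile p).mul continuous_const).continuousAt
  have h0 : c ^ 2 / 2 < profile p 0 * c := by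
    simp only [profile, mul_zero, Real.exp_zero, mul_one, ← hc]
    nlinarith
  obtain ⟨η, hη, hball⟩ := Metric.eventually_nhds_iff.1 (hcont.eventually (lt_mem_nhds h0))
  -- For `σ ≥ 2 log r + m`, points at distance at most `2r` have `|z|²/t ≤ 4 · η/8 < η`.
  set m := -Real.log (η / 8) with hm
  have hexpm : Real.exp (-m) = η / 8 := by rw [hm, neg_neg, Real.exp_log (by positivity)]
  set A := Real.sqrt (C * 4 / c ^ 2 * Real.exp (d * (m + 1))) with hA
  refine ⟨A, Real.sqrt_nonneg _, fun x₀ r hr => ?_⟩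
  set B := Metric.ball x₀ r with hB
  set s := 2 * Real.log r with hs
  have hrs : Real.exp (-s) * r ^ 2 = 1 := by
    rw [hs, Real.exp_neg, two_mul, Real.exp_add, Real.exp_log hr]
    field_simp
  have hrd : Real.exp (-(d : ℝ) * s) * (r ^ d) ^ 2 = 1 := by
    rw [← pow_mul, mul_comm d 2, pow_mul, show -(d : ℝ) * s = d * (-s) by ring,
      Real.exp_nat_mul, ← mul_pow, hrs, one_pow]
  set κ := μ.real B ^ 2 * Real.exp (-(d : ℝ) * (s + m + 1)) * (c ^ 2 / 4) with hκ
  have hT : ∀ x ∈ B, ∀ σ ∈ Icc (s + m) (s + m + 1),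
      κ ≤ polyTransform d p (μ.restrict B) σ x ^ 2 := by
    rintro x hx σ ⟨hσ1, hσ2⟩
    have hlow : μ.real B * (Real.exp (-(d : ℝ) / 2 * σ) * (c ^ 2 / 2)) ≤
        polyTransform d p (μ.restrict B) σ x * c := by
      rw [polyTransform, ← integral_mul_const, ← smul_eq_mul, ← setIntegral_const]
      refine setIntegral_mono_on (integrable_const _)
        ((integrable_polyKernel d p (μ.restrict B) σ x).mul_const c) measurableSet_ball
        fun y hy => ?_
      rw [polyKernel, mul_assoc]
      refine mul_le_mul_of_nonneg_left (hball ?_).le (Real.exp_pos _).le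
      have hxy : ‖x - y‖ ≤ 2 * r := by
        rw [← dist_eq_norm]
        have h1 := Metric.mem_ball.1 hx
        have h2 := Metric.mem_ball'.1 hy
        linarith [dist_triangle x x₀ y]
      rw [Real.dist_eq, sub_zero, abs_of_nonneg (by positivity)]
      calc ‖x - y‖ ^ 2 * Real.exp (-σ) ≤ (2 * r) ^ 2 * Real.exp (-s + -m) := by
            gcongr; linarith
        _ = 4 * (Real.exp (-s) * r ^ 2) * Real.exp (-m) := by rw [Real.exp_add]; ring
        _ < η := by rw [hrs, hexpm]; linarith
    have hsq := pow_le_pow_left₀ (by positivity) hlow 2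
    have e1 : Real.exp (-(d : ℝ) / 2 * σ) ^ 2 = Real.exp (-(d : ℝ) * σ) := by
      rw [← Real.exp_nat_mul]; congr 1; push_cast; ring
    rw [mul_pow, mul_pow, mul_pow, e1] at hsq
    have h3 : μ.real B ^ 2 * Real.exp (-(d : ℝ) * σ) * (c ^ 2 / 4) ≤
        polyTransform d p (μ.restrict B) σ x ^ 2 := by
      refine le_of_mul_le_mul_right ?_ hc2
      calc _ = μ.real B ^ 2 * (Real.exp (-(d : ℝ) * σ) * (c ^ 2 / 2) ^ 2) := by ring
        _ ≤ _ := hsq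
    refine le_trans ?_ h3
    rw [hκ]
    refine mul_le_mul_of_nonneg_right (mul_le_mul_of_nonneg_left (Real.exp_le_exp.2 ?_)
      (sq_nonneg _)) (by positivity)
    rw [neg_mul, neg_mul, neg_le_neg_iff]
    gcongr
  have hsf : ∀ x ∈ B, ENNReal.ofReal κ ≤ squareFunction d p (μ.restrict B) x := by
    intro x hx
    calc ENNReal.ofReal κ = ∫⁻ _ in Icc (s + m) (s + m + 1), ENNReal.ofReal κ := by
          rw [setLIntegral_const, Real.volume_Icc]; simp
      _ ≤ ∫⁻ σ in Icc (s + m) (s + m + 1),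
            ENNReal.ofReal (polyTransform d p (μ.restrict B) σ x ^ 2) :=
          setLIntegral_mono' measurableSet_Icc fun σ hσ =>
            ENNReal.ofReal_le_ofReal (hT x hx σ hσ)
      _ ≤ _ := setLIntegral_le_lintegral _ _
  have hmain : ENNReal.ofReal κ * μ B ≤ C * μ B := by
    rw [← setLIntegral_const]
    exact (setLIntegral_mono' measurableSet_ball hsf).trans
      ((setLIntegral_le_lintegral _ _).trans (hC B measurableSet_ball))
  by_cases hB0 : μ B = 0
  · rw [Measure.real, hB0, ENNReal.toReal_zero]; positivity
  have hκC : κ ≤ C := by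
    have := (ENNReal.mul_le_mul_iff_left hB0 (measure_ne_top μ B)).1 hmain
    rwa [← ENNReal.ofReal_coe_nnreal, ENNReal.ofReal_le_ofReal_iff C.coe_nonneg] at this
  refine abs_le_of_sq_le_sq' ?_ (by positivity) |>.2
  rw [mul_pow, hA, Real.sq_sqrt (by positivity)]
  have e2 : Real.exp (-(d : ℝ) * (s + m + 1)) * Real.exp (d * (m + 1)) * (r ^ d) ^ 2 = 1 := by
    rw [← Real.exp_add, show -(d : ℝ) * (s + m + 1) + d * (m + 1) = -(d : ℝ) * s by ring, hrd]
  calc μ.real B ^ 2 = κ * (4 / c ^ 2 * (Real.exp (d * (m + 1)) * (r ^ d) ^ 2)) := by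
        rw [hκ]
        have : c ^ 2 / 4 * (4 / c ^ 2) = 1 := by field_simp
        linear_combination (-μ.real B ^ 2) * e2 -
          μ.real B ^ 2 * Real.exp (-(d : ℝ) * (s + m + 1)) *
            (Real.exp (d * (m + 1)) * (r ^ d) ^ 2) * this
    _ ≤ C * (4 / c ^ 2 * (Real.exp (d * (m + 1)) * (r ^ d) ^ 2)) := by gcongr
    _ = _ := by ring

/-- Upper `d`-regularity of `μ`, in the form of a bound on the convolution of `μ` with
`exp (-|z|/√t)`, `t = exp σ`. -/
def ExpRegular (d : ℕ) (μ : Measure (EuclideanSpace ℝ (Fin n))) (A : ℝ) : Prop :=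
  ∀ (σ : ℝ) (x : EuclideanSpace ℝ (Fin n)),
    ∫ y, Real.exp (-(‖x - y‖ * Real.exp (-σ / 2))) ∂μ ≤ A * Real.exp ((d : ℝ) / 2 * σ)

/-- Split into shells by the integer part `k` of `|x - y|/√t`: the `k`-th lies in a ball of radius
`(k + 1)√t`, and the series of `e^(-k) (k + 1)^d` converges. -/
theorem exists_expRegular {d : ℕ} {μ : Measure (EuclideanSpace ℝ (Fin n))} [IsFiniteMeasure μ]
    {A : ℝ} (hA : 0 ≤ A) (h : ∀ (x : EuclideanSpace ℝ (Fin n)) (r : ℝ), 0 < r →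
      μ.real (Metric.ball x r) ≤ A * r ^ d) :
    ∃ A' : ℝ, 0 ≤ A' ∧ ExpRegular d μ A' := by
  have hsum : Summable fun k : ℕ => Real.exp (-(k : ℝ)) * ((k : ℝ) + 1) ^ d := by
    have := (summable_nat_add_iff 1).2 (Real.summable_pow_mul_exp_neg_nat_mul d one_pos)
    refine (this.mul_left (Real.exp 1)).congr fun k => ?_
    push_cast
    rw [mul_comm, mul_assoc, ← Real.exp_add, mul_comm]
    ring_nf
  set Z := ∑' k : ℕ, Real.exp (-(k : ℝ)) * ((k : ℝ) + 1) ^ d with hZ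
  have hZ0 : 0 ≤ Z := tsum_nonneg fun k => by positivity
  refine ⟨A * Z, by positivity, fun σ x => ?_⟩
  set R := Real.exp (σ / 2) with hR
  have hRpos : 0 < R := Real.exp_pos _
  have hRinv : Real.exp (-σ / 2) = R⁻¹ := by rw [hR, ← Real.exp_neg, neg_div]
  have hRd : R ^ d = Real.exp ((d : ℝ) / 2 * σ) := by
    rw [hR, ← Real.exp_nat_mul]; ring_nf
  rw [integral_eq_lintegral_of_nonneg_ae (Filter.Eventually.of_forall fun y => (Real.exp_pos _).le)
    (by fun_prop : Continuous fun y => Real.exp (-(‖x - y‖ * Real.exp (-σ / 2)))).aestronglyMeasurable]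
  refine ENNReal.toReal_le_of_le_ofReal (by positivity) ?_
  calc ∫⁻ y, ENNReal.ofReal (Real.exp (-(‖x - y‖ * Real.exp (-σ / 2)))) ∂μ
      ≤ ∫⁻ y, ∑' k : ℕ, (Metric.ball x (((k : ℝ) + 1) * R)).indicator
          (fun _ => ENNReal.ofReal (Real.exp (-(k : ℝ)))) y ∂μ := by
        refine lintegral_mono fun y => ?_
        set v := ‖x - y‖ * Real.exp (-σ / 2) with hv
        have hv0 : 0 ≤ v := by positivity
        refine le_trans ?_ (ENNReal.le_tsum ⌊v⌋₊)
        have hmem : y ∈ Metric.ball x (((⌊v⌋₊ : ℝ) + 1) * R) := by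
          rw [Metric.mem_ball', dist_eq_norm, ← div_lt_iff₀ hRpos, div_eq_mul_inv, ← hRinv]
          exact Nat.lt_floor_add_one v
        rw [indicator_of_mem hmem]
        exact ENNReal.ofReal_le_ofReal (Real.exp_le_exp.2 (neg_le_neg (Nat.floor_le hv0)))
    _ = ∑' k : ℕ, ENNReal.ofReal (Real.exp (-(k : ℝ))) *
          μ (Metric.ball x (((k : ℝ) + 1) * R)) := by
        rw [lintegral_tsum fun k => (measurable_const.indicator measurableSet_ball).aemeasurable]
        simp only [lintegral_indicator_const measurableSet_ball]
    _ ≤ ∑' k : ℕ, ENNReal.ofReal (A * R ^ d * (Real.exp (-(k : ℝ)) * ((k : ℝ) + 1) ^ d)) := by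
        refine ENNReal.tsum_le_tsum fun k => ?_
        rw [← ENNReal.ofReal_toReal (measure_ne_top μ (Metric.ball x _)),
          ← ENNReal.ofReal_mul (Real.exp_pos _).le]
        refine ENNReal.ofReal_le_ofReal ?_
        have := h x (((k : ℝ) + 1) * R) (by positivity)
        calc _ ≤ Real.exp (-(k : ℝ)) * (A * (((k : ℝ) + 1) * R) ^ d) := by
              gcongr; exact this
          _ = _ := by rw [mul_pow]; ring
    _ = ENNReal.ofReal (A * Z * Real.exp ((d : ℝ) / 2 * σ)) := by
        rw [← ENNReal.ofReal_tsum_of_nonneg (fun k => by positivity) (hsum.mul_left _),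
          tsum_mul_left, ← hZ, hRd]
        congr 1; ring

theorem ExpRegular.abs_integral_le {d : ℕ} {μ : Measure (EuclideanSpace ℝ (Fin n))}
    [IsFiniteMeasure μ] {A : ℝ} (hA : ExpRegular d μ A) {B : ℝ} (hB : 0 ≤ B) {σ : ℝ}
    {x : EuclideanSpace ℝ (Fin n)} {f : EuclideanSpace ℝ (Fin n) → ℝ}
    (hf : ∀ y, |f y| ≤ B * Real.exp (-(d : ℝ) / 2 * σ) *
      Real.exp (-(‖x - y‖ * Real.exp (-σ / 2)))) :
    |∫ y, f y ∂μ| ≤ B * A := by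
  have hint : Integrable (fun y => Real.exp (-(‖x - y‖ * Real.exp (-σ / 2)))) μ := by
    refine Integrable.of_bound (C := 1) (by fun_prop : Continuous fun y =>
      Real.exp (-(‖x - y‖ * Real.exp (-σ / 2)))).aestronglyMeasurable
      (Filter.Eventually.of_forall fun y => ?_)
    rw [Real.norm_eq_abs, Real.abs_exp, Real.exp_le_one_iff, neg_nonpos]
    positivity
  have h := norm_integral_le_of_norm_le (f := f) (hint.const_mul (B * Real.exp (-(d : ℝ) / 2 * σ)))
    (Filter.Eventually.of_forall fun y => hf y)
  rw [integral_const_mul, Real.norm_eq_abs] at h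
  refine h.trans ?_
  calc _ ≤ B * Real.exp (-(d : ℝ) / 2 * σ) * (A * Real.exp ((d : ℝ) / 2 * σ)) := by
        gcongr; exact hA σ x
    _ = B * A * (Real.exp (-(d : ℝ) / 2 * σ) * Real.exp ((d : ℝ) / 2 * σ)) := by ring
    _ = B * A := by rw [← Real.exp_add]; ring_nf; simp

/-! ### Size, tail and Lipschitz bounds for the convolutions -/

theorem ExpRegular.exists_abs_polyTransform_le {d : ℕ}
    {μ : Measure (EuclideanSpace ℝ (Fin n))} [IsFiniteMeasure μ] {A : ℝ} (hA0 : 0 ≤ A)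
    (hA : ExpRegular d μ A) (p : Polynomial ℝ) :
    ∃ C : ℝ, 0 ≤ C ∧ ∀ σ x, |polyTransform d p μ σ x| ≤ C := by
  obtain ⟨C, hC, h⟩ := exists_abs_polyKernel_le (n := n) d p
  refine ⟨C * A, by positivity, fun σ x => hA.abs_integral_le hC (σ := σ) (x := x) fun y => ?_⟩
  refine (h σ (x - y)).trans (mul_le_mul_of_nonneg_left (Real.exp_le_exp.2 ?_) (by positivity))
  have : 0 ≤ ‖x - y‖ * Real.exp (-σ / 2) := by positivity
  linarith

theorem ExpRegular.exists_abs_polyTransform_compl_le {d : ℕ}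
    {μ : Measure (EuclideanSpace ℝ (Fin n))} [IsFiniteMeasure μ] {A : ℝ} (hA0 : 0 ≤ A)
    (hA : ExpRegular d μ A) (p : Polynomial ℝ) :
    ∃ C : ℝ, 0 ≤ C ∧ ∀ Ω : Set (EuclideanSpace ℝ (Fin n)), MeasurableSet Ω → ∀ s σ x,
      (∀ y ∉ Ω, Real.exp (s / 2) ≤ dist x y) →
        |polyTransform d p (μ.restrict Ωᶜ) σ x| ≤ C * Real.exp (-(s - σ) / 2) := by
  obtain ⟨C, hC, h⟩ := exists_abs_polyKernel_le (n := n) d p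
  refine ⟨C * A, by positivity, fun Ω hΩ s σ x hs => ?_⟩
  rw [polyTransform, ← integral_indicator hΩ.compl, mul_right_comm]
  refine hA.abs_integral_le (by positivity) (σ := σ) (x := x) fun y => ?_
  by_cases hy : y ∈ Ω
  · rw [indicator_of_notMem (by simpa using hy), abs_zero]; positivity
  rw [indicator_of_mem (by simpa using hy)]
  refine (h σ (x - y)).trans ?_
  have h1 : Real.exp (s / 2) * Real.exp (-σ / 2) ≤ ‖x - y‖ * Real.exp (-σ / 2) := by
    rw [← dist_eq_norm]; gcongr; exact hs y hy
  rw [← Real.exp_add] at h1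
  -- The spare factor `exp (-v)` has `v ≥ exp ((s - σ)/2) ≥ (s - σ)/2`, which gives the decay in `s
  -- - σ`.
  have h2 := Real.add_one_le_exp (s / 2 + -σ / 2)
  have h3 : Real.exp (-2 * (‖x - y‖ * Real.exp (-σ / 2))) ≤
      Real.exp (-(s - σ) / 2) * Real.exp (-(‖x - y‖ * Real.exp (-σ / 2))) := by
    rw [← Real.exp_add, Real.exp_le_exp]; linarith
  calc _ ≤ C * Real.exp (-(d : ℝ) / 2 * σ) *
        (Real.exp (-(s - σ) / 2) * Real.exp (-(‖x - y‖ * Real.exp (-σ / 2)))) := by gcongr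
    _ = _ := by ring

theorem ExpRegular.exists_abs_polyTransform_sub_le {d : ℕ}
    {μ : Measure (EuclideanSpace ℝ (Fin n))} [IsFiniteMeasure μ] {A : ℝ} (hA0 : 0 ≤ A)
    (hA : ExpRegular d μ A) (p : Polynomial ℝ) :
    ∃ C : ℝ, 0 ≤ C ∧ ∀ σ x x', dist x x' * Real.exp (-σ / 2) ≤ 1 →
      |polyTransform d p μ σ x - polyTransform d p μ σ x'| ≤
        C * (dist x x' * Real.exp (-σ / 2)) := by
  obtain ⟨C, hC, h⟩ := exists_abs_profile_sq_sub_le p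
  refine ⟨C * A, by positivity, fun σ x x' hx => ?_⟩
  rw [polyTransform, polyTransform, ← integral_sub (integrable_polyKernel d p μ σ x)
    (integrable_polyKernel d p μ σ x'), mul_right_comm]
  refine hA.abs_integral_le (by positivity) (σ := σ) (x := x) fun y => ?_
  set v := ‖x - y‖ * Real.exp (-σ / 2) with hv
  set w := ‖x' - y‖ * Real.exp (-σ / 2) with hw
  have hv0 : 0 ≤ v := by positivity
  have hw0 : 0 ≤ w := by positivity
  have hvw : |v - w| ≤ dist x x' * Real.exp (-σ / 2) := by
    rw [hv, hw, ← sub_mul, abs_mul, Real.abs_exp]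
    gcongr
    refine (abs_norm_sub_norm_le _ _).trans_eq ?_
    rw [sub_sub_sub_cancel_right, dist_eq_norm]
  rw [polyKernel, polyKernel, ← mul_sub, abs_mul, Real.abs_exp, norm_sq_mul_exp_neg,
    norm_sq_mul_exp_neg, ← hv, ← hw]
  calc _ ≤ Real.exp (-(d : ℝ) / 2 * σ) *
        (C * (dist x x' * Real.exp (-σ / 2)) * Real.exp (-v)) := by
        refine mul_le_mul_of_nonneg_left ((h v w hv0 hw0 (hvw.trans hx)).trans ?_)
          (Real.exp_pos _).le
        gcongr
        linarith
    _ = _ := by ring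

theorem lintegral_Ioi_exp_half (s : ℝ) :
    ∫⁻ σ in Ioi s, ENNReal.ofReal (Real.exp ((s - σ) / 2)) = ENNReal.ofReal 2 := by
  have e : ∀ σ, Real.exp ((s - σ) / 2) = Real.exp (s / 2) * Real.exp (-(1 / 2) * σ) := fun σ => by
    rw [← Real.exp_add]; ring_nf
  simp only [e]
  rw [← ofReal_integral_eq_lintegral_ofReal
    ((integrableOn_exp_mul_Ioi (by norm_num) s).const_mul _)
    (Filter.Eventually.of_forall fun σ => by positivity), integral_const_mul,
    integral_exp_mul_Ioi (by norm_num)]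
  congr 1
  have : Real.exp (s / 2) * Real.exp (-(1 / 2) * s) = 1 := by
    rw [← Real.exp_add]; ring_nf; simp
  linear_combination 2 * this

theorem lintegral_Iic_exp (s c : ℝ) :
    ∫⁻ σ in Iic c, ENNReal.ofReal (Real.exp (-(s - σ))) = ENNReal.ofReal (Real.exp (c - s)) := by
  have e : ∀ σ, Real.exp (-(s - σ)) = Real.exp (-s) * Real.exp σ := fun σ => by
    rw [← Real.exp_add]; ring_nf
  simp only [e]
  rw [← ofReal_integral_eq_lintegral_ofReal ((integrableOn_exp_Iic c).const_mul _)
    (Filter.Eventually.of_forall fun σ => by positivity), integral_const_mul, integral_exp_Iic,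
    ← Real.exp_add]
  ring_nf

/-! ### The good-λ inequality and exponential decay -/

/-- The part of the square function that comes from the scales `σ > s`. -/
def truncSquareFunction (d : ℕ) (p : Polynomial ℝ) (ν : Measure (EuclideanSpace ℝ (Fin n)))
    (s : ℝ) (x : EuclideanSpace ℝ (Fin n)) : ℝ≥0∞ :=
  ∫⁻ σ in Ioi s, ENNReal.ofReal (polyTransform d p ν σ x ^ 2)

/-- A difference of squares is at most the uniform bound on the sum times the Lipschitz bound `L exp
((s - σ)/2)`; the latter integrates over `σ > s` to `2L`, whatever `s` is. -/
theorem ExpRegular.exists_truncSquareFunction_le {d : ℕ}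
    {μ : Measure (EuclideanSpace ℝ (Fin n))} [IsFiniteMeasure μ] {A : ℝ} (hA0 : 0 ≤ A)
    (hA : ExpRegular d μ A) (p : Polynomial ℝ) :
    ∃ C : ℝ, 0 ≤ C ∧ ∀ s x x', dist x x' ≤ Real.exp (s / 2) →
      truncSquareFunction d p μ s x ≤ truncSquareFunction d p μ s x' + ENNReal.ofReal C := by
  obtain ⟨B, hB, hb⟩ := hA.exists_abs_polyTransform_le hA0 p
  obtain ⟨L, hL, hl⟩ := hA.exists_abs_polyTransform_sub_le hA0 p
  refine ⟨2 * B * L * 2, by positivity, fun s x x' hx => ?_⟩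
  rw [truncSquareFunction, truncSquareFunction, ENNReal.ofReal_mul (by positivity),
    ← lintegral_Ioi_exp_half s, ← lintegral_const_mul' _ _ ENNReal.ofReal_ne_top,
    ← lintegral_add_left (measurable_ofReal_polyTransform_sq_right d p μ x')]
  refine setLIntegral_mono' measurableSet_Ioi fun σ hσ => ?_
  rw [mem_Ioi] at hσ
  rw [← ENNReal.ofReal_mul (by positivity), ← ENNReal.ofReal_add (sq_nonneg _) (by positivity)]
  refine ENNReal.ofReal_le_ofReal ?_
  have h1 : dist x x' * Real.exp (-σ / 2) ≤ Real.exp ((s - σ) / 2) := by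
    rw [show (s - σ) / 2 = s / 2 + -σ / 2 by ring, Real.exp_add]; gcongr
  have h2 : Real.exp ((s - σ) / 2) ≤ 1 := Real.exp_le_one_iff.2 (by linarith)
  have h3 : |polyTransform d p μ σ x - polyTransform d p μ σ x'| ≤
      L * Real.exp ((s - σ) / 2) := (hl σ x x' (h1.trans h2)).trans (by gcongr)
  have h4 : |polyTransform d p μ σ x + polyTransform d p μ σ x'| ≤ 2 * B :=
    (abs_add_le _ _).trans (by linarith [hb σ x, hb σ x'])
  have h5 := mul_le_mul h4 h3 (abs_nonneg _) (by positivity)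
  rw [← abs_mul] at h5
  have h6 := (le_abs_self _).trans h5
  nlinarith

theorem exists_lt_truncSquareFunction {d : ℕ} {p : Polynomial ℝ}
    {ν : Measure (EuclideanSpace ℝ (Fin n))} {x : EuclideanSpace ℝ (Fin n)} {b : ℝ≥0∞}
    (h : b < squareFunction d p ν x) : ∃ s, b < truncSquareFunction d p ν s x := by
  have hU : ⋃ k : ℕ, Ioi (-(k : ℝ)) = univ := eq_univ_of_forall fun σ => by
    obtain ⟨k, hk⟩ := exists_nat_gt (-σ)
    exact mem_iUnion.2 ⟨k, by rw [mem_Ioi]; linarith⟩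
  have hdir : Monotone fun k : ℕ => Ioi (-(k : ℝ)) := fun i j hij =>
    Ioi_subset_Ioi (neg_le_neg (by exact_mod_cast hij))
  rw [squareFunction, ← setLIntegral_univ, ← hU,
    setLIntegral_iUnion_of_directed _ hdir.directed_le, lt_iSup_iff] at h
  exact h.imp' (fun k : ℕ => -(k : ℝ)) fun k hk => hk

theorem polyTransform_restrict_add_compl (d : ℕ) (p : Polynomial ℝ)
    (μ : Measure (EuclideanSpace ℝ (Fin n))) [IsFiniteMeasure μ]
    {Ω : Set (EuclideanSpace ℝ (Fin n))} (hΩ : MeasurableSet Ω) (σ : ℝ)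
    (x : EuclideanSpace ℝ (Fin n)) :
    polyTransform d p (μ.restrict Ω) σ x + polyTransform d p (μ.restrict Ωᶜ) σ x =
      polyTransform d p μ σ x :=
  integral_add_compl hΩ (integrable_polyKernel d p μ σ x)

/-- At a point where the square function exceeds `l + C + L`, the scales that carry the excess `L`
do not see the complement of `Ω = {squareFunction > l}`. -/
theorem exists_le_setLIntegral_and_compl_le {d : ℕ} {μ : Measure (EuclideanSpace ℝ (Fin n))}
    [IsFiniteMeasure μ] {p : Polynomial ℝ} {C D : ℝ} (hC : 0 ≤ C)
    (hC' : ∀ s x x', dist x x' ≤ Real.exp (s / 2) →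
      truncSquareFunction d p μ s x ≤ truncSquareFunction d p μ s x' + ENNReal.ofReal C)
    (hD' : ∀ Ω : Set (EuclideanSpace ℝ (Fin n)), MeasurableSet Ω → ∀ s σ x,
      (∀ y ∉ Ω, Real.exp (s / 2) ≤ dist x y) →
        |polyTransform d p (μ.restrict Ωᶜ) σ x| ≤ D * Real.exp (-(s - σ) / 2))
    {l L : ℝ} (hl : 0 ≤ l) (hL : 0 ≤ L) {Ω : Set (EuclideanSpace ℝ (Fin n))}
    (hΩ : Ω = {x | ENNReal.ofReal l < squareFunction d p μ x})
    {x : EuclideanSpace ℝ (Fin n)}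
    (hx : ENNReal.ofReal (l + C + L) < squareFunction d p μ x) :
    ∃ I : Set ℝ, ENNReal.ofReal L ≤
        ∫⁻ σ in I, ENNReal.ofReal (polyTransform d p μ σ x ^ 2) ∧
      ∫⁻ σ in I, ENNReal.ofReal (polyTransform d p (μ.restrict Ωᶜ) σ x ^ 2) ≤
        ENNReal.ofReal (D ^ 2 * Real.exp 1) := by
  have hΩm : MeasurableSet Ω := by
    rw [hΩ]; exact measurableSet_lt measurable_const (measurable_squareFunction d p μ)
  set S := {s | ENNReal.ofReal (l + C) < truncSquareFunction d p μ s x} with hS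
  -- A point `y ∉ Ω` within `exp (s/2)` of `x` would force the truncation at `x` to be at most `l +
  -- C`.
  have hdist : ∀ s ∈ S, ∀ y ∉ Ω, Real.exp (s / 2) ≤ dist x y := by
    intro s hs y hy
    by_contra! hlt
    rw [hΩ, mem_ofPred_eq, not_lt] at hy
    refine absurd ((hC' s x y hlt.le).trans (add_le_add_left
      ((setLIntegral_le_lintegral _ _).trans hy) _)) (not_le.2 ?_)
    rw [← ENNReal.ofReal_add hl hC]
    exact hs
  obtain ⟨s₀, hs₀⟩ : S.Nonempty := exists_lt_truncSquareFunction
    ((ENNReal.ofReal_le_ofReal (by linarith)).trans_lt hx)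
  by_cases hbdd : BddAbove S
  -- With `s ∈ S` but `s + 1 ∉ S`, the scales above `s + 1` account for at most `l + C` and leave
  -- `L` below, while the distance estimate still holds at `s`. The unit gap costs the factor `exp
  -- 1`.
  · obtain ⟨s, hs, hs1⟩ := exists_lt_of_lt_csSup ⟨s₀, hs₀⟩ (sub_one_lt (sSup S))
    have hs2 : s + 1 ∉ S := fun h => by linarith [le_csSup hbdd h]
    refine ⟨Iic (s + 1), ?_, ?_⟩
    · rw [hS, mem_ofPred_eq, not_lt] at hs2
      rw [squareFunction, ← lintegral_add_compl _ (measurableSet_Iic (a := s + 1)),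
        compl_Iic, ENNReal.ofReal_add (by positivity) hL] at hx
      by_contra! h
      exact absurd hx (not_lt.2 ((add_le_add h.le hs2).trans_eq (add_comm _ _)))
    · calc _ ≤ ∫⁻ σ in Iic (s + 1), ENNReal.ofReal (D ^ 2) *
              ENNReal.ofReal (Real.exp (-(s - σ))) := by
            refine lintegral_mono fun σ => ?_
            simp only
            rw [← ENNReal.ofReal_mul (sq_nonneg _)]
            refine ENNReal.ofReal_le_ofReal ?_
            have h := pow_le_pow_left₀ (abs_nonneg _) (hD' Ω hΩm s σ x (hdist s hs)) 2
            rw [sq_abs, mul_pow, ← Real.exp_nat_mul] at h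
            refine h.trans_eq ?_
            congr 2
            push_cast; ring
        _ = _ := by
            rw [lintegral_const_mul' _ _ ENNReal.ofReal_ne_top, lintegral_Iic_exp,
              ← ENNReal.ofReal_mul (sq_nonneg _), add_sub_cancel_left]
  -- Arbitrarily large `s ∈ S` would put every point of the complement arbitrarily far from `x`.
  · have hempty : Ωᶜ = ∅ := by
      refine eq_empty_of_forall_notMem fun y hy => ?_
      obtain ⟨s, hs, hs1⟩ := not_bddAbove_iff.1 hbdd (2 * dist x y)
      have h1 := hdist s hs y hy
      have h2 := Real.add_one_le_exp (s / 2)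
      linarith
    refine ⟨univ, ?_, ?_⟩
    · rw [setLIntegral_univ]
      exact (ENNReal.ofReal_le_ofReal (by linarith)).trans hx.le
    · simp [hempty, polyTransform]

theorem exists_measureReal_squareFunction_le_half {d : ℕ}
    {μ : Measure (EuclideanSpace ℝ (Fin n))} [IsFiniteMeasure μ] {p : Polynomial ℝ} {B : NNReal}
    (hB : ∀ Ω : Set (EuclideanSpace ℝ (Fin n)), MeasurableSet Ω →
      ∫⁻ x, squareFunction d p (μ.restrict Ω) x ∂μ ≤ B * μ Ω)
    {A : ℝ} (hA0 : 0 ≤ A) (hA : ExpRegular d μ A) :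
    ∃ K : ℝ, 0 < K ∧ ∀ l : ℝ, 0 ≤ l →
      μ.real {x | ENNReal.ofReal (l + K) < squareFunction d p μ x} ≤
        μ.real {x | ENNReal.ofReal l < squareFunction d p μ x} / 2 := by
  obtain ⟨C, hC, hC'⟩ := hA.exists_truncSquareFunction_le hA0 p
  obtain ⟨D, hD, hD'⟩ := hA.exists_abs_polyTransform_compl_le hA0 p
  set E := D ^ 2 * Real.exp 1 with hE
  have hE0 : 0 ≤ E := by positivity
  -- Chebyshev yields the ratio `B / M`, which is below `1/2`.
  set M : ℝ := 2 * B + 1 with hM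
  have hM0 : 0 < M := by positivity
  -- The excess `2E + 2M` survives `(u + v)^2 ≤ 2u^2 + 2v^2`: removing the part `2E` from the
  -- complement leaves `M` for `Ω`.
  refine ⟨C + (2 * E + 2 * M), by positivity, fun l hl => ?_⟩
  set Ω := {x | ENNReal.ofReal l < squareFunction d p μ x} with hΩ
  have hΩm : MeasurableSet Ω := measurableSet_lt measurable_const (measurable_squareFunction d p μ)
  have hlow : {x | ENNReal.ofReal (l + (C + (2 * E + 2 * M))) < squareFunction d p μ x} ⊆
      {x | ENNReal.ofReal M ≤ squareFunction d p (μ.restrict Ω) x} := by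
    intro x hx
    rw [mem_ofPred_eq, ← add_assoc] at hx
    obtain ⟨I, hI1, hI2⟩ := exists_le_setLIntegral_and_compl_le hC hC' hD' hl
      (by positivity) hΩ hx
    have hle : ∫⁻ σ in I, ENNReal.ofReal (polyTransform d p μ σ x ^ 2) ≤
        2 * squareFunction d p (μ.restrict Ω) x + 2 * ENNReal.ofReal E := by
      calc _ ≤ ∫⁻ σ in I, (2 * ENNReal.ofReal (polyTransform d p (μ.restrict Ω) σ x ^ 2) +
              2 * ENNReal.ofReal (polyTransform d p (μ.restrict Ωᶜ) σ x ^ 2)) := by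
            refine lintegral_mono fun σ => ?_
            simp only
            have e : ∀ u : ℝ, 2 * ENNReal.ofReal u = ENNReal.ofReal (2 * u) := fun u => by
              rw [ENNReal.ofReal_mul two_pos.le, ENNReal.ofReal_ofNat]
            rw [e, e, ← ENNReal.ofReal_add (by positivity) (by positivity),
              ← polyTransform_restrict_add_compl d p μ hΩm]
            refine ENNReal.ofReal_le_ofReal ?_
            linarith [sq_nonneg (polyTransform d p (μ.restrict Ω) σ x -
              polyTransform d p (μ.restrict Ωᶜ) σ x)]
        _ = 2 * (∫⁻ σ in I, ENNReal.ofReal (polyTransform d p (μ.restrict Ω) σ x ^ 2)) +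
              2 * ∫⁻ σ in I, ENNReal.ofReal (polyTransform d p (μ.restrict Ωᶜ) σ x ^ 2) := by
            rw [lintegral_add_left ((measurable_ofReal_polyTransform_sq_right d p _ x).const_mul 2),
              lintegral_const_mul' _ _ (by norm_num), lintegral_const_mul' _ _ (by norm_num)]
        _ ≤ _ := by
            gcongr
            exact setLIntegral_le_lintegral _ _
    have h := hI1.trans hle
    rw [ENNReal.ofReal_add (by positivity) (by positivity), add_comm,
      ENNReal.ofReal_mul (by norm_num), ENNReal.ofReal_mul (by norm_num), ENNReal.ofReal_ofNat,
      ENNReal.add_le_add_iff_right (ENNReal.mul_ne_top (by norm_num) ENNReal.ofReal_ne_top),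
      ENNReal.mul_le_mul_iff_right (by norm_num) (by norm_num)] at h
    exact h
  have hcheb := (mul_meas_ge_le_lintegral (μ := μ)
    (measurable_squareFunction d p (μ.restrict Ω)) (ENNReal.ofReal M)).trans (hB Ω hΩm)
  have hreal := ENNReal.toReal_mono (ENNReal.mul_ne_top ENNReal.coe_ne_top (measure_ne_top μ Ω))
    ((mul_le_mul_right (measure_mono hlow) _).trans hcheb)
  rw [ENNReal.toReal_mul, ENNReal.toReal_mul, ENNReal.toReal_ofReal hM0.le,
    ENNReal.coe_toReal] at hreal
  change M * μ.real _ ≤ B * μ.real Ω at hreal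
  have h1 : 0 ≤ μ.real Ω := measureReal_nonneg
  have hB0 : (0 : ℝ) ≤ B := B.coe_nonneg
  by_contra! hlt
  rw [hM] at hreal
  nlinarith

/-- Iterate the halving from `l = 0`; the factor `2` pays for rounding `l` down to a multiple of
`K`. -/
theorem exists_measureReal_squareFunction_le_exp {d : ℕ}
    {μ : Measure (EuclideanSpace ℝ (Fin n))} [IsFiniteMeasure μ] {p : Polynomial ℝ} {K : ℝ}
    (hK : 0 < K) (h : ∀ l : ℝ, 0 ≤ l →
      μ.real {x | ENNReal.ofReal (l + K) < squareFunction d p μ x} ≤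
        μ.real {x | ENNReal.ofReal l < squareFunction d p μ x} / 2) {l : ℝ} (hl : 0 ≤ l) :
    μ.real {x | ENNReal.ofReal l < squareFunction d p μ x} ≤
      2 * μ.real univ * Real.exp (-(Real.log 2 / K) * l) := by
  have hiter : ∀ m : ℕ, μ.real {x | ENNReal.ofReal (m * K) < squareFunction d p μ x} ≤
      μ.real univ * Real.exp (-(m * Real.log 2)) := by
    intro m
    induction m with
    | zero => simpa using measureReal_mono (subset_univ _)
    | succ m ih =>
      have e : ((m + 1 : ℕ) : ℝ) * K = m * K + K := by push_cast; ring
      have e2 : Real.exp (-(((m + 1 : ℕ) : ℝ) * Real.log 2)) =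
          Real.exp (-(m * Real.log 2)) / 2 := by
        rw [show -(((m + 1 : ℕ) : ℝ) * Real.log 2) = -(m * Real.log 2) + -Real.log 2 by
          push_cast; ring, Real.exp_add, Real.exp_neg (Real.log 2), Real.exp_log two_pos,
          div_eq_mul_inv]
      rw [e, e2]
      have := h (m * K) (by positivity)
      linarith
  have hfl : (⌊l / K⌋₊ : ℝ) * K ≤ l := by
    rw [← le_div_iff₀ hK]; exact Nat.floor_le (by positivity)
  calc _ ≤ μ.real {x | ENNReal.ofReal (⌊l / K⌋₊ * K) < squareFunction d p μ x} :=
        measureReal_mono fun x hx => (ENNReal.ofReal_le_ofReal hfl).trans_lt hx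
    _ ≤ μ.real univ * Real.exp (-(⌊l / K⌋₊ * Real.log 2)) := hiter _
    _ ≤ μ.real univ * Real.exp (Real.log 2 + -(Real.log 2 / K) * l) := by
        refine mul_le_mul_of_nonneg_left (Real.exp_le_exp.2 ?_) measureReal_nonneg
        have := mul_le_mul_of_nonneg_right (Nat.lt_floor_add_one (l / K)).le
          (Real.log_pos one_lt_two).le
        have e : l / K * Real.log 2 = Real.log 2 / K * l := by ring
        linarith
    _ = _ := by rw [Real.exp_add, Real.exp_log two_pos]; ring

/-! ### Counting steep zeros -/

/-- By Rolle, `f'` vanishes between the zeros, and it needs length more than `ε / M` to get from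
above `ε` in absolute value down to `0`. -/
theorem lt_dist_of_deriv_eq_zero {f f' f'' : ℝ → ℝ} (hf : ∀ σ, HasDerivAt f (f' σ) σ)
    (hf' : ∀ σ, HasDerivAt f' (f'' σ) σ) {M ε : ℝ} (hM0 : 0 < M) (hM : ∀ σ, |f'' σ| ≤ M) {s t : ℝ}
    (hst : s < t) (hs : f s = 0) (ht : f t = 0) (hε : ε < |f' s|) : ε / M < t - s := by
  obtain ⟨ξ, ⟨h1, h2⟩, h3⟩ := exists_hasDerivAt_eq_zero hst
    (fun σ _ => (hf σ).continuousAt.continuousWithinAt) (hs.trans ht.symm) fun σ _ => hf σ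
  have h := convex_univ.norm_image_sub_le_of_norm_hasDerivWithin_le
    (fun σ _ => (hf' σ).hasDerivWithinAt) (fun σ _ => hM σ) (mem_univ ξ) (mem_univ s)
  rw [h3, sub_zero, Real.norm_eq_abs, Real.norm_eq_abs, abs_sub_comm,
    abs_of_pos (sub_pos.2 h1)] at h
  rw [div_lt_iff₀ hM0]
  nlinarith

/-- The zeros of `f` at which `|f'| > ε` are counted by the square integral of `f'`, if `f''` is
bounded. -/
theorem card_mul_le_lintegral_sq {f f' f'' : ℝ → ℝ} (hf : ∀ σ, HasDerivAt f (f' σ) σ)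
    (hf' : ∀ σ, HasDerivAt f' (f'' σ) σ) {M ε : ℝ} (hM0 : 0 < M) (hM : ∀ σ, |f'' σ| ≤ M)
    (hε : 0 < ε) (F : Finset ℝ) (hF : ∀ τ ∈ F, f τ = 0 ∧ ε < |f' τ|) :
    F.card * ENNReal.ofReal (ε ^ 3 / (4 * M)) ≤ ∫⁻ σ, ENNReal.ofReal (f' σ ^ 2) := by
  -- Intervals of radius `r` about the zeros are disjoint, and `|f'| ≥ ε/2` on them, so each
  -- contributes `2r (ε/2)^2 = ε^3 / (4M)`. This is the source of the cube of `δ`.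
  set r := ε / (2 * M) with hr
  have hr0 : 0 < r := by positivity
  have hrM : r * M = ε / 2 := by rw [hr]; field_simp
  have hr2 : ε / M = 2 * r := by rw [hr]; field_simp
  have hsep : ∀ s ∈ F, ∀ t ∈ F, s < t → 2 * r < t - s := fun s hs t ht hst => by
    rw [← hr2]
    exact lt_dist_of_deriv_eq_zero hf hf' hM0 hM hst (hF s hs).1 (hF t ht).1 (hF s hs).2
  have hdisj : (F : Set ℝ).PairwiseDisjoint fun τ => Ioo (τ - r) (τ + r) := by
    intro s hs t ht hne
    refine Set.disjoint_left.2 fun u hu hu' => ?_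
    rcases lt_or_gt_of_ne hne with h | h
    · have := hsep s hs t ht h
      linarith [hu.2, hu'.1]
    · have := hsep t ht s hs h
      linarith [hu.1, hu'.2]
  have hlow : ∀ τ ∈ F, ENNReal.ofReal (ε ^ 3 / (4 * M)) ≤
      ∫⁻ σ in Ioo (τ - r) (τ + r), ENNReal.ofReal (f' σ ^ 2) := by
    intro τ hτ
    calc ENNReal.ofReal (ε ^ 3 / (4 * M))
        = ∫⁻ _ in Ioo (τ - r) (τ + r), ENNReal.ofReal ((ε / 2) ^ 2) := by
          rw [setLIntegral_const, Real.volume_Ioo, ← ENNReal.ofReal_mul (by positivity)]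
          congr 1
          rw [hr]
          field_simp
          ring
      _ ≤ _ := by
          refine setLIntegral_mono' measurableSet_Ioo fun σ hσ => ENNReal.ofReal_le_ofReal ?_
          have h := convex_univ.norm_image_sub_le_of_norm_hasDerivWithin_le
            (fun σ _ => (hf' σ).hasDerivWithinAt) (fun σ _ => hM σ) (mem_univ σ) (mem_univ τ)
          rw [Real.norm_eq_abs, Real.norm_eq_abs] at h
          have h1 : |τ - σ| ≤ r := abs_le.2 ⟨by linarith [hσ.2], by linarith [hσ.1]⟩
          have h2 : M * |τ - σ| ≤ ε / 2 := by
            rw [← hrM, mul_comm r]; gcongr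
          have h3 := abs_sub_abs_le_abs_sub (f' τ) (f' σ)
          rw [← sq_abs (f' σ)]
          refine pow_le_pow_left₀ (by positivity) ?_ 2
          linarith [(hF τ hτ).2]
  calc F.card * ENNReal.ofReal (ε ^ 3 / (4 * M))
      = ∑ τ ∈ F, ENNReal.ofReal (ε ^ 3 / (4 * M)) := by rw [Finset.sum_const, nsmul_eq_mul]
    _ ≤ ∑ τ ∈ F, ∫⁻ σ in Ioo (τ - r) (τ + r), ENNReal.ofReal (f' σ ^ 2) := Finset.sum_le_sum hlow
    _ = ∫⁻ σ in ⋃ τ ∈ F, Ioo (τ - r) (τ + r), ENNReal.ofReal (f' σ ^ 2) :=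
        (lintegral_biUnion_finset hdisj (fun _ _ => measurableSet_Ioo) _).symm
    _ ≤ _ := setLIntegral_le_lintegral _ _

/-- Passing to `f^2`, which is differentiable, gives `f f' = 0`. If `f` vanished at the local
maximum of `|f|`, it would vanish nearby, against `f'' ≠ 0`. -/
theorem deriv_eq_zero_of_isLocalMax_abs {f f' f'' : ℝ → ℝ} (hf : ∀ σ, HasDerivAt f (f' σ) σ)
    (hf' : ∀ σ, HasDerivAt f' (f'' σ) σ) {τ : ℝ} (hmax : IsLocalMax (fun σ => |f σ|) τ)
    (hne : f'' τ ≠ 0) : f' τ = 0 := by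
  have hsq : IsLocalMax (fun σ => f σ ^ 2) τ := hmax.mono fun σ hσ => sq_le_sq.2 hσ
  have h := hsq.hasDerivAt_eq_zero ((hf τ).pow 2)
  simp only [Nat.cast_ofNat, Nat.add_one_sub_one, pow_one, mul_eq_zero, OfNat.ofNat_ne_zero,
    false_or] at h
  refine h.resolve_left fun h0 => hne ?_
  have hz : f =ᶠ[nhds τ] fun _ => 0 := hmax.mono fun σ hσ => by
    simpa [h0] using hσ
  have hd : deriv f = f' := funext fun σ => (hf σ).deriv
  have hz' := hz.deriv.deriv_eq
  rw [hd, (hf' τ).deriv] at hz'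
  simpa using hz'

/-! ### From local scales to the square function -/

theorem iteratedDeriv_two_logScaleTransform (d : ℕ) {a : ℝ} (ha : 1 < a)
    (μ : Measure (EuclideanSpace ℝ (Fin n))) [IsFiniteMeasure μ]
    (x : EuclideanSpace ℝ (Fin n)) (τ : ℝ) :
    iteratedDeriv 2 (logScaleTransform d a μ x) τ =
      polyTransform d (scalePoly d) μ (τ * Real.log a) x * Real.log a ^ 2 := by
  have hT : ∀ (p : Polynomial ℝ) (τ : ℝ),
      HasDerivAt (fun τ => polyTransform d p μ (τ * Real.log a) x)
        (polyTransform d (eulerOp d p) μ (τ * Real.log a) x * Real.log a) τ := fun p τ => by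
    have h := (hasDerivAt_polyTransform d p μ (τ * Real.log a) x).comp τ
      ((hasDerivAt_id τ).mul_const (Real.log a))
    rw [one_mul] at h
    exact h
  have h1 : deriv (logScaleTransform d a μ x) =
      fun τ => polyTransform d (eulerOp d (derivPoly d 1)) μ (τ * Real.log a) x * Real.log a := by
    rw [funext (logScaleTransform_eq d ha μ x)]
    exact funext fun τ => (hT _ τ).deriv
  rw [iteratedDeriv_succ, iteratedDeriv_one, h1, ((hT _ τ).mul_const _).deriv, scalePoly]
  ring

theorem polyTransform_eq_zero_of_mem_logLocalScales {d : ℕ} {a : ℝ} (ha : 1 < a)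
    {μ : Measure (EuclideanSpace ℝ (Fin n))} [IsFiniteMeasure μ]
    {x : EuclideanSpace ℝ (Fin n)} {τ : ℝ} (hτ : τ ∈ logLocalScales d a μ x)
    (hne : polyTransform d (scalePoly d) μ (τ * Real.log a) x ≠ 0) :
    polyTransform d (eulerOp d (derivPoly d 1)) μ (τ * Real.log a) x = 0 := by
  obtain ⟨t, ⟨ht, hmax⟩, rfl⟩ := hτ
  have hlog : Real.log a ≠ 0 := (Real.log_pos ha).ne'
  have e : Real.logb a t * Real.log a = Real.log t := div_mul_cancel₀ _ hlog
  rw [e] at hne ⊢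
  have hS : ∀ σ, scaleTransform d μ x (Real.exp σ) = polyTransform d (derivPoly d 1) μ σ x := by
    intro σ
    have h := logScaleTransform_eq d ha μ x (σ / Real.log a)
    rw [div_mul_cancel₀ _ hlog, logScaleTransform, Real.rpow_def_of_pos (by linarith),
      mul_div_cancel₀ _ hlog] at h
    exact h
  refine deriv_eq_zero_of_isLocalMax_abs
    (fun σ => hasDerivAt_polyTransform d (derivPoly d 1) μ σ x)
    (fun σ => hasDerivAt_polyTransform d (eulerOp d (derivPoly d 1)) μ σ x) ?_ hne
  have htend : Filter.Tendsto Real.exp (nhds (Real.log t)) (nhds t) := by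
    have := Real.continuous_exp.tendsto (Real.log t)
    rwa [Real.exp_log ht] at this
  filter_upwards [htend.eventually hmax] with σ hσ
  rwa [← hS, ← hS, Real.exp_log ht]

theorem lt_squareFunction_of_mem_manyScales {d : ℕ} {a : ℝ} (ha : 1 < a)
    {Γ : Set (EuclideanSpace ℝ (Fin n))} {μ : Measure (EuclideanSpace ℝ (Fin n))}
    [IsFiniteMeasure μ] {M : ℝ} (hM0 : 0 < M)
    (hM : ∀ σ x, |polyTransform d (eulerOp d (scalePoly d)) μ σ x| ≤ M) {δ : ℝ} (hδ : 0 < δ)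
    {N : ℕ} {x : EuclideanSpace ℝ (Fin n)} (hx : x ∈ manyScales d a Γ μ δ N) :
    ENNReal.ofReal (N * ((δ / Real.log a ^ 2) ^ 3 / (4 * M))) <
      squareFunction d (scalePoly d) μ x := by
  have hlog : 0 < Real.log a := Real.log_pos ha
  -- Passing from `τ` to `σ = τ log a` divides second derivatives by `(log a)^2`.
  set ε := δ / Real.log a ^ 2 with hε
  have hε0 : 0 < ε := by positivity
  -- The set of scales may be infinite; a subset of exactly `N + 1` elements suffices and makes the
  -- inequality strict.
  obtain ⟨U, hU, hUcard⟩ := Set.exists_subset_encard_eq (Order.add_one_le_of_lt hx.2)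
  have hUfin : U.Finite := Set.finite_of_encard_eq_coe (k := N + 1) (by exact_mod_cast hUcard)
  set F := hUfin.toFinset.image (· * Real.log a) with hF
  have hcard : F.card = N + 1 := by
    rw [hF, Finset.card_image_of_injective _ (mul_left_injective₀ hlog.ne')]
    rw [hUfin.encard_eq_coe_toFinset_card] at hUcard
    exact_mod_cast hUcard
  have hmem : ∀ σ ∈ F, polyTransform d (eulerOp d (derivPoly d 1)) μ σ x = 0 ∧
      ε < |polyTransform d (scalePoly d) μ σ x| := by
    intro σ hσ
    obtain ⟨τ, hτ, rfl⟩ := Finset.mem_image.1 hσ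
    obtain ⟨h1, h2⟩ := hU (hUfin.mem_toFinset.1 hτ)
    rw [iteratedDeriv_two_logScaleTransform d ha, abs_mul,
      abs_of_pos (by positivity : 0 < Real.log a ^ 2), ← div_lt_iff₀ (by positivity)] at h2
    exact ⟨polyTransform_eq_zero_of_mem_logLocalScales ha h1 (abs_pos.1 (hε0.trans h2)), h2⟩
  have h := card_mul_le_lintegral_sq
    (fun σ => hasDerivAt_polyTransform d (eulerOp d (derivPoly d 1)) μ σ x)
    (fun σ => hasDerivAt_polyTransform d (scalePoly d) μ σ x) hM0 (fun σ => hM σ x) hε0 F hmem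
  refine lt_of_lt_of_le ?_ h
  rw [hcard, ← ENNReal.ofReal_natCast, ← ENNReal.ofReal_mul (by positivity)]
  have hpos : 0 < ε ^ 3 / (4 * M) := by positivity
  refine (ENNReal.ofReal_lt_ofReal_iff (by positivity)).2 ?_
  push_cast
  linarith

end LocalScales

end

/-- `μ` ranges over all finite Borel measures carried by `Γ`. For a `d`-dimensional Borel set `Γ`
with finite `d`-dimensional Hausdorff measure this includes the restriction to `Γ` of the Hausdorff
measure, under any normalization, and the surface measure or the image of Lebesgue measure under a
parametrization of a bounded `Γ`. -/
theorem mainTheorem1 {n d : ℕ} (hd : 1 ≤ d) (hdn : d < n)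
    (Γ : Set (EuclideanSpace ℝ (Fin n))) (hΓ : Bornology.IsBounded Γ)
    (μ : MeasureTheory.Measure (EuclideanSpace ℝ (Fin n))) [MeasureTheory.IsFiniteMeasure μ]
    (hμΓ : μ Γᶜ = 0)
    (a : ℝ) (ha : 1 < a)
    (hg : LocalScales.LittlewoodPaleyBounded d μ)
    (hlog : LocalScales.LogDerivBounded d a Γ μ) :
    ∃ C₁ C₂ : ℝ, 0 < C₁ ∧ 0 < C₂ ∧ ∀ δ : ℝ, 0 < δ → ∀ N : ℕ,
      μ (LocalScales.manyScales d a Γ μ δ N)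
        ≤ ENNReal.ofReal (C₁ * Real.exp (-C₂ * δ ^ 3 * N)) := by
  open LocalScales in
  obtain ⟨B, hB⟩ := exists_lintegral_squareFunction_le hg
  obtain ⟨A, hA0, hA⟩ := exists_measure_ball_le (eval_zero_scalePoly_ne_zero hd) hB
  obtain ⟨A', hA0', hA'⟩ := exists_expRegular hA0 hA
  obtain ⟨K, hK, hhalf⟩ := exists_measureReal_squareFunction_le_half hB hA0' hA'
  obtain ⟨M, hM0, hM⟩ := hA'.exists_abs_polyTransform_le hA0' (eulerOp d (scalePoly d))
  have hloga : 0 < Real.log a := Real.log_pos ha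
  have hlog2 : 0 < Real.log 2 := Real.log_pos one_lt_two
  have hμ0 : 0 ≤ μ.real univ := measureReal_nonneg
  -- The summands `1` keep the constants positive and well defined if `μ` or `M` is zero; `(log
  -- a)^6` is the cube of the factor `(log a)^2` in `ε`.
  refine ⟨2 * μ.real univ + 1, Real.log 2 / K * (1 / (Real.log a ^ 6 * (4 * (M + 1)))),
    by positivity, by positivity, fun δ hδ N => ?_⟩
  set l := N * ((δ / Real.log a ^ 2) ^ 3 / (4 * (M + 1))) with hl
  have hl0 : 0 ≤ l := by positivity
  calc μ (manyScales d a Γ μ δ N)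
      ≤ μ {x | ENNReal.ofReal l < squareFunction d (scalePoly d) μ x} :=
        measure_mono fun x hx => lt_squareFunction_of_mem_manyScales ha (by positivity)
          (fun σ x => (hM σ x).trans (by linarith)) hδ hx
    _ = ENNReal.ofReal (μ.real {x | ENNReal.ofReal l < squareFunction d (scalePoly d) μ x}) :=
        ENNReal.ofReal_toReal (measure_ne_top μ _) |>.symm
    _ ≤ _ := by
        refine ENNReal.ofReal_le_ofReal
          ((exists_measureReal_squareFunction_le_exp hK hhalf hl0).trans ?_)
        have e : -(Real.log 2 / K) * l =
            -(Real.log 2 / K * (1 / (Real.log a ^ 6 * (4 * (M + 1))))) * δ ^ 3 * N := by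
          rw [hl]; field_simp
        rw [e]
        exact mul_le_mul_of_nonneg_right (by linarith) (Real.exp_pos _).le
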